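/- Theorem (Explicit version of Theorem 4.11 in Titchmarsh). Let $\gamma$ be the Euler–Mascheroni constant and put $$C=\frac1\pi\Bigl(\pi+3\gamma+3\log\Bigl(1+\frac1{2\pi}\Bigr)+\frac{2\pi}{2\pi-1}\Bigr).$$ Then $C=2.0708$ to four decimal places (that is, $|C-2.0708|\le 5\cdot10^{-5}$), and in particular $C<\frac{29}{14}$. Let $x>0$ be a real number and let $s=\sigma+it$ with $\sigma\ge 0$ and $0<t\le x$. Then there is a complex number $\Theta$ with $|\Theta|\le 1$ such that $$\zeta(s)=\sum_{1\le n\le x}\frac1{n^{s}}+\frac{x^{1-s}}{s-1}+\frac{29}{14}\,\frac{\Theta}{x^{\sigma}},$$ where $\zeta$ is the Riemann zeta function. Moreover, the same holds with the constant $\frac{29}{14}$ replaced by $C$ (with a possibly different $\Theta$, $|\Theta|\le1$). -/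

import Mathlib

/-- The constant `(π + 3γ + 3 log (1 + 1/(2π)) + 2π/(2π - 1)) / π`, where `γ` is the
Euler–Mascheroni constant. -/
noncomputable def zetaApproxConst : ℝ :=
  (Real.pi + 3 * Real.eulerMascheroniConstant + 3 * Real.log (1 + 1 / (2 * Real.pi))
    + 2 * Real.pi / (2 * Real.pi - 1)) / Real.pi

/-! The approximation is proved with the constant 11/6, which is smaller than both `zetaApproxConst`
and 29/14; the value of `zetaApproxConst` is a separate numerical computation.

For σ > 0, ζ(s) is the limit of ∑_{n ≤ N} n^{-s} + N^{1-s}/(s-1), so the error at x is the limit of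
∑_{x < n ≤ N} n^{-s} - ∫_x^N v^{-s} dv. Partial summation against the decreasing weight v^{-σ}
reduces its estimate to the exponent it, where Euler–Maclaurin leaves two boundary terms of size at
most 1/2 and t|∫ ψ(v) v^{-it-1} dv|, with ψ the sawtooth.

The trivial bound for this integral is useless over a long range. Integrating by parts replaces ψ by
its primitive B₂({v})/2, whose cosine series is absolutely convergent. Each frequency satisfies 2πn
> 6 while t ≤ v, so the phase 2πnv ± t log v has no stationary point and a further integration by
parts gives `norm_integral_cexp_mul_cpow_le`. Hence t times the integral is at most 5/6
(`mul_norm_integral_sawtooth_mul_cpow_le`), and 1/2 + 1/2 + 5/6 = 11/6. The line σ = 0 follows by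
continuity. -/

/-! ### Numerical evaluation of the constant -/

theorem le_log_one_add_inv {a : ℝ} (ha : 0 < a) :
    2 * (1 / (2 * a + 1) + (1 / (2 * a + 1)) ^ 3 / 3) ≤ Real.log (1 + a⁻¹) := by
  have h := Real.hasSum_log_one_add_inv ha
  have := h.summable.sum_le_tsum (Finset.range 2) (fun k _ => by positivity)
  rw [h.tsum_eq, Finset.sum_range_succ, Finset.sum_range_one] at this
  refine le_trans (le_of_eq ?_) this
  norm_num
  ring

/-- With y = 1/(2a+1), the logarithm is 2 ∑ y^(2k+1)/(2k+1); from k = 2 on, 1/(2k+1) ≤ 1/5 makes the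
tail geometric. -/
theorem log_one_add_inv_le {a : ℝ} (ha : 0 < a) :
    Real.log (1 + a⁻¹) ≤ 2 * (1 / (2 * a + 1) + (1 / (2 * a + 1)) ^ 3 / 3
      + (1 / (2 * a + 1)) ^ 5 / 5 / (1 - (1 / (2 * a + 1)) ^ 2)) := by
  have h := Real.hasSum_log_one_add_inv ha
  have hy0 : 0 < 1 / (2 * a + 1) := by positivity
  have hy1 : 1 / (2 * a + 1) < 1 := by
    rw [div_lt_one (by positivity)]; linarith
  set y := 1 / (2 * a + 1)
  have hy2 : y ^ 2 < 1 := by nlinarith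
  have h' := (hasSum_nat_add_iff' 2).mpr h
  have hg := (hasSum_geometric_of_lt_one (sq_nonneg y) hy2).mul_left (2 / 5 * y ^ 5)
  have hle := hasSum_le (fun k => ?_) h' hg
  · rw [Finset.sum_range_succ, Finset.sum_range_one] at hle
    norm_num at hle
    rw [div_eq_mul_inv _ (1 - y ^ 2)]
    linarith
  · have h1 : y ^ (2 * (k + 2) + 1) = y ^ 5 * (y ^ 2) ^ k := by ring
    rw [h1, ← mul_assoc]
    have h2 : 2 * (1 / (2 * ((k + 2 : ℕ) : ℝ) + 1)) ≤ 2 / 5 := by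
      rw [mul_one_div]
      gcongr
      push_cast
      have : (0 : ℝ) ≤ k := k.cast_nonneg
      linarith
    gcongr

/-- The Euler–Maclaurin approximation of second order to the Euler–Mascheroni constant. -/
noncomputable def eulerMascheroniApprox (n : ℕ) : ℝ :=
  harmonic n - Real.log n - 1 / (2 * n) + 1 / (12 * n ^ 2)

theorem eulerMascheroniApprox_sub_succ {n : ℕ} (hn : n ≠ 0) :
    eulerMascheroniApprox n - eulerMascheroniApprox (n + 1) =
      Real.log (1 + (n : ℝ)⁻¹) - 1 / (n + 1 : ℝ) - 1 / (2 * n) + 1 / (2 * (n + 1 : ℝ))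
        + 1 / (12 * n ^ 2) - 1 / (12 * (n + 1 : ℝ) ^ 2) := by
  have hn' : (0 : ℝ) < n := by positivity
  have : Real.log (1 + (n : ℝ)⁻¹) = Real.log (n + 1) - Real.log n := by
    rw [← Real.log_div (by positivity) (by positivity)]
    congr 1
    field_simp
  rw [this, eulerMascheroniApprox, eulerMascheroniApprox, harmonic_succ]
  push_cast
  ring

theorem eulerMascheroniApprox_succ_le {n : ℕ} (hn : n ≠ 0) :
    eulerMascheroniApprox (n + 1) ≤ eulerMascheroniApprox n := by
  have hn' : (0 : ℝ) < n := by positivity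
  -- Shifting to b = n - 1 ≥ 0 leaves, after clearing denominators, an expression in b that
  -- `positivity` can treat term by term.
  obtain ⟨b, hb, hb'⟩ : ∃ b : ℝ, 0 ≤ b ∧ (n : ℝ) = b + 1 :=
    ⟨n - 1, sub_nonneg.mpr (by exact_mod_cast Nat.one_le_iff_ne_zero.mpr hn), by ring⟩
  have hlog := le_log_one_add_inv hn'
  have hsub := eulerMascheroniApprox_sub_succ hn
  rw [hb'] at hlog hsub
  have key : 0 ≤ 2 * (1 / (2 * (b + 1) + 1) + (1 / (2 * (b + 1) + 1)) ^ 3 / 3) - 1 / (b + 1 + 1)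
      - 1 / (2 * (b + 1)) + 1 / (2 * (b + 1 + 1)) + 1 / (12 * (b + 1) ^ 2)
      - 1 / (12 * (b + 1 + 1) ^ 2) := by
    have h1 : b + 1 ≠ 0 := by positivity
    have h2 : b + 1 + 1 ≠ 0 := by positivity
    have h3 : 2 * (b + 1) + 1 ≠ 0 := by positivity
    field_simp
    rw [← sub_nonneg]
    ring_nf
    positivity
  linarith

/-- The next Euler–Maclaurin term is 1/(120 n⁴); subtracting twice that amount turns the decreasing
sequence into an increasing one, so γ is enclosed from both sides. -/
theorem eulerMascheroniApprox_sub_succ_le {n : ℕ} (hn : n ≠ 0) :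
    eulerMascheroniApprox n - 1 / (60 * n ^ 4) ≤
      eulerMascheroniApprox (n + 1) - 1 / (60 * ((n + 1 : ℕ) : ℝ) ^ 4) := by
  have hn' : (0 : ℝ) < n := by positivity
  obtain ⟨b, hb, hb'⟩ : ∃ b : ℝ, 0 ≤ b ∧ (n : ℝ) = b + 1 :=
    ⟨n - 1, sub_nonneg.mpr (by exact_mod_cast Nat.one_le_iff_ne_zero.mpr hn), by ring⟩
  have hlog := log_one_add_inv_le hn'
  have hsub := eulerMascheroniApprox_sub_succ hn
  push_cast
  rw [hb'] at hlog hsub ⊢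
  have h0 : (1 / (2 * (b + 1) + 1)) ^ 5 / 5 / (1 - (1 / (2 * (b + 1) + 1)) ^ 2) =
      1 / (20 * (b + 1) * (b + 2) * (2 * (b + 1) + 1) ^ 3) := by
    have : 1 - (1 / (2 * (b + 1) + 1)) ^ 2 = 4 * (b + 1) * (b + 2) / (2 * (b + 1) + 1) ^ 2 := by
      field_simp
      ring
    rw [this]
    field_simp
    norm_num
  rw [h0] at hlog
  have key : 0 ≤ 1 / (60 * (b + 1) ^ 4) - 1 / (60 * (b + 1 + 1) ^ 4) -
      (2 * (1 / (2 * (b + 1) + 1) + (1 / (2 * (b + 1) + 1)) ^ 3 / 3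
        + 1 / (20 * (b + 1) * (b + 2) * (2 * (b + 1) + 1) ^ 3)) - 1 / (b + 1 + 1)
      - 1 / (2 * (b + 1)) + 1 / (2 * (b + 1 + 1)) + 1 / (12 * (b + 1) ^ 2)
      - 1 / (12 * (b + 1 + 1) ^ 2)) := by
    have h1 : b + 1 ≠ 0 := by positivity
    have h2 : b + 1 + 1 = b + 2 := by ring
    have h2' : b + 2 ≠ 0 := by positivity
    have h3 : 2 * (b + 1) + 1 ≠ 0 := by positivity
    rw [h2]
    field_simp
    rw [← sub_nonneg]
    ring_nf
    positivity
  linarith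

open Filter Topology in
theorem tendsto_eulerMascheroniApprox :
    Tendsto eulerMascheroniApprox atTop (𝓝 Real.eulerMascheroniConstant) := by
  have h1 : Tendsto (fun n : ℕ => 1 / (2 * (n : ℝ))) atTop (𝓝 0) :=
    tendsto_const_nhds.div_atTop (tendsto_natCast_atTop_atTop.const_mul_atTop two_pos)
  have h2 : Tendsto (fun n : ℕ => 1 / (12 * (n : ℝ) ^ 2)) atTop (𝓝 0) :=
    tendsto_const_nhds.div_atTop (((tendsto_pow_atTop two_ne_zero).comp
      tendsto_natCast_atTop_atTop).const_mul_atTop (by norm_num))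
  have h := (Real.tendsto_harmonic_sub_log.sub h1).add h2
  rwa [sub_zero, add_zero] at h

theorem eulerMascheroniConstant_le_approx {n : ℕ} (hn : n ≠ 0) :
    Real.eulerMascheroniConstant ≤ eulerMascheroniApprox n := by
  refine le_of_tendsto tendsto_eulerMascheroniApprox ?_
  filter_upwards [Filter.eventually_ge_atTop n] with m hm
  induction m, hm using Nat.le_induction with
  | base => rfl
  | succ m hm ih => exact (eulerMascheroniApprox_succ_le (by omega)).trans ih

open Filter Topology in
theorem approx_sub_le_eulerMascheroniConstant {n : ℕ} (hn : n ≠ 0) :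
    eulerMascheroniApprox n - 1 / (60 * n ^ 4) ≤ Real.eulerMascheroniConstant := by
  have h2 : Tendsto (fun n : ℕ => 1 / (60 * (n : ℝ) ^ 4)) atTop (𝓝 0) :=
    tendsto_const_nhds.div_atTop (((tendsto_pow_atTop four_ne_zero).comp
      tendsto_natCast_atTop_atTop).const_mul_atTop (by norm_num))
  have h := tendsto_eulerMascheroniApprox.sub h2
  rw [sub_zero] at h
  refine ge_of_tendsto h ?_
  filter_upwards [Filter.eventually_ge_atTop n] with m hm
  induction m, hm using Nat.le_induction with
  | base => rfl
  | succ m hm ih => exact ih.trans (eulerMascheroniApprox_sub_succ_le (by omega))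

theorem eulerMascheroniApprox_eight :
    eulerMascheroniApprox 8 = 761 / 280 - 3 * Real.log 2 - 1 / 16 + 1 / 768 := by
  have : Real.log 8 = 3 * Real.log 2 := by
    rw [show (8 : ℝ) = 2 ^ 3 by norm_num, Real.log_pow]
    norm_num
  rw [eulerMascheroniApprox]
  push_cast
  rw [this]
  norm_num [harmonic, Finset.sum_range_succ]

theorem abs_zetaApproxConst_sub_le : |zetaApproxConst - 2.0708| ≤ 0.00005 := by
  have hpi := Real.pi_gt_d6
  have hpi' := Real.pi_lt_d6
  -- At n = 8 the enclosure of γ has width 1/(60·8⁴) < 5·10⁻⁶, and log 8 = 3 log 2 is known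
  -- precisely.
  have hg := eulerMascheroniConstant_le_approx (n := 8) (by norm_num)
  have hg' := approx_sub_le_eulerMascheroniConstant (n := 8) (by norm_num)
  rw [eulerMascheroniApprox_eight] at hg hg'
  have hl2 := Real.log_two_gt_d9
  have hl2' := Real.log_two_lt_d9
  have h2pi : 0 < 2 * Real.pi := by positivity
  have hl := le_log_one_add_inv h2pi
  have hl' := log_one_add_inv_le h2pi
  rw [inv_eq_one_div] at hl hl'
  set y := 1 / (2 * (2 * Real.pi) + 1) with hy
  have hy1 : 0.0737116 ≤ y := by
    rw [hy, le_div_iff₀ (by positivity)]; linarith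
  have hy2 : y ≤ 0.0737118 := by
    rw [hy, div_le_iff₀ (by positivity)]; linarith
  have hq1 : 1.189279 ≤ 2 * Real.pi / (2 * Real.pi - 1) := by
    rw [le_div_iff₀ (by linarith)]; linarith
  have hq2 : 2 * Real.pi / (2 * Real.pi - 1) ≤ 1.189281 := by
    rw [div_le_iff₀ (by linarith)]; linarith
  have hy3 : 0.0737116 ^ 3 ≤ y ^ 3 := by gcongr
  have hy3' : y ^ 3 ≤ 0.0737118 ^ 3 := by gcongr
  have hy5 : y ^ 5 / 5 / (1 - y ^ 2) ≤ 0.0737118 ^ 5 / 5 / (1 - 0.0737118 ^ 2) := by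
    gcongr
  norm_num at hg' hy3 hy3' hy5
  rw [zetaApproxConst, abs_le]
  constructor
  · rw [le_sub_iff_add_le, le_div_iff₀ Real.pi_pos]
    linarith
  · rw [sub_le_iff_le_add, div_le_iff₀ Real.pi_pos]
    linarith

theorem zetaApproxConst_lt : zetaApproxConst < 29 / 14 := by
  have := (abs_le.mp abs_zetaApproxConst_sub_le).2
  norm_num at this ⊢
  linarith

/-! ### The sawtooth function and Euler–Maclaurin summation -/

/-- The sawtooth function `v ↦ v - ⌊v⌋ - 1 / 2` on the nonnegative reals. -/
noncomputable def sawtooth (v : ℝ) : ℝ := v - ⌊v⌋₊ - 1 / 2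

theorem abs_sawtooth_le {v : ℝ} (hv : 0 ≤ v) : |sawtooth v| ≤ 1 / 2 := by
  have h1 := Nat.floor_le hv
  have h2 := Nat.lt_floor_add_one v
  rw [sawtooth, abs_le]
  constructor <;> linarith

theorem measurable_sawtooth : Measurable sawtooth := by
  unfold sawtooth
  have : Measurable fun v : ℝ => ((⌊v⌋₊ : ℕ) : ℝ) := by fun_prop
  fun_prop

open MeasureTheory in
theorem intervalIntegrable_sawtooth_mul {f : ℝ → ℂ} {a b : ℝ} (ha : 0 ≤ a) (hab : a ≤ b)
    (hf : ContinuousOn f (Set.Icc a b)) :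
    IntervalIntegrable (fun v => (sawtooth v : ℂ) * f v) volume a b := by
  rw [intervalIntegrable_iff_integrableOn_Icc_of_le hab]
  refine Integrable.bdd_mul (c := 1 / 2) hf.integrableOn_Icc
    (Complex.measurable_ofReal.comp measurable_sawtooth).aestronglyMeasurable ?_
  filter_upwards [ae_restrict_mem measurableSet_Icc] with v hv
  rw [Complex.norm_real, Real.norm_eq_abs]
  exact abs_sawtooth_le (ha.trans hv.1)

open MeasureTheory intervalIntegral in
/-- First-order Euler–Maclaurin summation. -/
theorem sum_Ioc_floor_eq_integral_add {f f' : ℝ → ℂ} {a b : ℝ} (ha : 0 ≤ a) (hab : a ≤ b)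
    (hf : ∀ v ∈ Set.Icc a b, HasDerivAt f (f' v) v) (hf' : ContinuousOn f' (Set.Icc a b)) :
    ∑ k ∈ Finset.Ioc ⌊a⌋₊ ⌊b⌋₊, f k = (∫ v in a..b, f v)
      - (sawtooth b : ℂ) * f b + (sawtooth a : ℂ) * f a
      + ∫ v in a..b, (sawtooth v : ℂ) * f' v := by
  have hu : Set.uIcc a b = Set.Icc a b := Set.uIcc_of_le hab
  have hderiv : Set.EqOn (deriv f) f' (Set.Icc a b) := fun v hv => (hf v hv).deriv
  have hint : IntegrableOn (deriv f) (Set.Icc a b) :=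
    (hf'.integrableOn_Icc).congr_fun hderiv.symm measurableSet_Icc
  have key := sum_mul_eq_sub_sub_integral_mul (fun _ => (1 : ℂ)) ha hab
    (fun v hv => (hf v hv).differentiableAt) hint
  have hi' := integrableOn_mul_sum_Icc (m := 0) (fun _ => (1 : ℂ)) ha hint
  -- Abel summation counts from k = 0, hence the + 1; the sawtooth is then (v + 1/2) - (⌊v⌋ + 1),
  -- and the first part is integrated by parts.
  have hcard (v : ℝ) : ∑ k ∈ Finset.Icc 0 ⌊v⌋₊, (1 : ℂ) = (⌊v⌋₊ : ℂ) + 1 := by simp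
  simp only [hcard, mul_one] at key hi'
  rw [key, ← integral_of_le hab]
  have hfi : IntervalIntegrable f' volume a b := (hu ▸ hf').intervalIntegrable
  have hi1 : IntervalIntegrable (fun v => f' v * ((⌊v⌋₊ : ℂ) + 1)) volume a b := by
    rw [intervalIntegrable_iff_integrableOn_Icc_of_le hab]
    exact hi'.congr_fun (fun v hv => by simp only [hderiv hv]) measurableSet_Icc
  have hi2 : IntervalIntegrable (fun v : ℝ => ((v : ℂ) + 1 / 2) * f' v) volume a b := by
    refine ContinuousOn.intervalIntegrable (hu ▸ ContinuousOn.mul ?_ hf')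
    fun_prop
  have h1 : ∫ v in a..b, deriv f v * ((⌊v⌋₊ : ℂ) + 1) = ∫ v in a..b, f' v * ((⌊v⌋₊ : ℂ) + 1) :=
    integral_congr fun v hv => by simp only [hderiv (hu ▸ hv)]
  have h2 : ∫ v in a..b, (sawtooth v : ℂ) * f' v =
      (∫ v in a..b, ((v : ℂ) + 1 / 2) * f' v) - ∫ v in a..b, f' v * ((⌊v⌋₊ : ℂ) + 1) := by
    rw [← integral_sub hi2 hi1]
    refine integral_congr fun v _ => ?_
    simp only [sawtooth]
    push_cast
    ring
  have h3 := integral_mul_deriv_eq_deriv_mul (a := a) (b := b) (v := f) (v' := f')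
    (u := fun v => (v : ℂ) + 1 / 2) (u' := fun _ => 1)
    (fun v _ => (Complex.ofRealCLM.hasDerivAt (x := v)).add_const _) (fun v hv => hf v (hu ▸ hv))
    intervalIntegrable_const hfi
  rw [h1, h2, h3]
  simp only [one_mul, sawtooth]
  push_cast
  ring

/-! ### Oscillatory integrals without stationary phase -/

-- The oscillating factor P = e^{ilv} v^{-it} has P' = i(lv - t)P/v, so the integrand is G P' with G
-- = 1/(iv(lv - t)). Since t ≤ v and |l| ≥ 6, lv - t stays away from 0; integration by parts costs
-- 1/5 + 1/5 + 1/2 ≤ 1 in units of 1/a².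
open MeasureTheory intervalIntegral in
theorem norm_integral_cexp_mul_cpow_le {l t a b : ℝ} (hl : 6 ≤ |l|) (ht : 0 < t) (hta : t ≤ a)
    (hab : a ≤ b) :
    ‖∫ v in a..b, Complex.exp (l * v * Complex.I) * (v : ℂ) ^ (-(t * Complex.I) - 2)‖
      ≤ 1 / a ^ 2 := by
  have ha : 0 < a := ht.trans_le hta
  have hu : Set.uIcc a b = Set.Icc a b := Set.uIcc_of_le hab
  set P : ℝ → ℂ := fun v => Complex.exp (l * v * Complex.I) * (v : ℂ) ^ (-(t * Complex.I)) with hP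
  set G : ℝ → ℂ := fun v => 1 / (Complex.I * (v * (l * v - t))) with hG
  set G' : ℝ → ℂ := fun v => -(2 * l * v - t) / (Complex.I * (v * (l * v - t)) ^ 2) with hG'
  have hPn {v : ℝ} (hv : v ∈ Set.Icc a b) : ‖P v‖ = 1 := by
    have hv0 : 0 < v := ha.trans_le hv.1
    rw [hP]
    simp only [norm_mul]
    rw [Complex.norm_cpow_eq_rpow_re_of_pos hv0, Complex.norm_exp]
    simp
  -- t ≤ v ≤ |l|v/6, which is where both t ≤ a and |l| ≥ 6 enter.
  have hlow {v : ℝ} (hv : v ∈ Set.Icc a b) : 5 / 6 * |l| * v ≤ |l * v - t| := by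
    have hv0 : 0 < v := ha.trans_le hv.1
    have h1 := abs_sub_abs_le_abs_sub (l * v) t
    rw [abs_mul, abs_of_pos hv0, abs_of_pos ht] at h1
    nlinarith [hv.1]
  have hne {v : ℝ} (hv : v ∈ Set.Icc a b) : ((l * v - t : ℝ) : ℂ) ≠ 0 := by
    have hv0 : 0 < v := ha.trans_le hv.1
    rw [Complex.ofReal_ne_zero, ← abs_pos]
    refine lt_of_lt_of_le ?_ (hlow hv)
    positivity
  push_cast at hne
  have hne0 {v : ℝ} (hv : v ∈ Set.Icc a b) : (v : ℂ) ≠ 0 :=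
    Complex.ofReal_ne_zero.mpr (ha.trans_le hv.1).ne'
  have htI : -(t * Complex.I) ≠ 0 := by simp [ht.ne']
  have hPd {v : ℝ} (hv : v ∈ Set.Icc a b) :
      HasDerivAt P (P v * (Complex.I * (l * v - t) / v)) v := by
    have h1 : HasDerivAt (fun v : ℝ => Complex.exp (l * v * Complex.I))
        (Complex.exp (l * v * Complex.I) * (l * 1 * Complex.I)) v :=
      (((Complex.ofRealCLM.hasDerivAt (x := v)).const_mul (l : ℂ)).mul_const Complex.I).cexp
    have h2 := hasDerivAt_ofReal_cpow_const (ha.trans_le hv.1).ne' htI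
    convert! h1.mul h2 using 1
    rw [Complex.cpow_sub _ _ (hne0 hv), Complex.cpow_one, hP]
    have := hne0 hv
    field_simp
    ring_nf
  have hGd {v : ℝ} (hv : v ∈ Set.Icc a b) : HasDerivAt G (G' v) v := by
    have h0 := Complex.ofRealCLM.hasDerivAt (x := v)
    have h1 := (h0.mul ((h0.const_mul (l : ℂ)).sub_const (t : ℂ))).const_mul Complex.I
    have h2 := h1.fun_inv (mul_ne_zero Complex.I_ne_zero (mul_ne_zero (hne0 hv) (hne hv)))
    simp only [hG, hG', one_div]
    convert! h2 using 1
    have h3 := hne0 hv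
    have h4 := hne hv
    simp only [Complex.ofRealCLM_apply, Complex.ofReal_one, Pi.mul_apply]
    have h5 := Complex.I_ne_zero
    field_simp
    ring
  have hGn {v : ℝ} (hv : v ∈ Set.Icc a b) : ‖G v‖ ≤ 1 / 5 * (1 / a ^ 2) := by
    have hv0 : 0 < v := ha.trans_le hv.1
    have h1 : G v = ((1 / (v * (l * v - t)) : ℝ) : ℂ) / Complex.I := by
      simp only [hG]; push_cast; field_simp
    rw [h1, norm_div, Complex.norm_I, div_one, Complex.norm_real, Real.norm_eq_abs, abs_div,
      abs_one, abs_mul, abs_of_pos hv0, one_div_mul_one_div]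
    refine one_div_le_one_div_of_le (by positivity) ?_
    calc 5 * a ^ 2 ≤ 5 / 6 * 6 * v ^ 2 := by
          norm_num
          exact pow_le_pow_left₀ ha.le hv.1 2
      _ ≤ 5 / 6 * |l| * v ^ 2 := by gcongr
      _ = v * (5 / 6 * |l| * v) := by ring
      _ ≤ _ := by gcongr; exact hlow hv
  -- The bounds 13/6 above and 5/6 below give (78/25)/(|l|v³), and 78/25 ≤ 6 ≤ |l|.
  have hG'n {v : ℝ} (hv : v ∈ Set.Icc a b) : ‖G' v‖ ≤ v ^ (-3 : ℝ) := by
    have hv0 : 0 < v := ha.trans_le hv.1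
    have h1 : G' v = ((-(2 * l * v - t) / (v * (l * v - t)) ^ 2 : ℝ) : ℂ) / Complex.I := by
      simp only [hG']; push_cast; field_simp
    have h2 : |2 * l * v - t| ≤ 13 / 6 * |l| * v := by
      have := abs_sub (2 * l * v) t
      rw [abs_mul, abs_mul, abs_of_pos hv0, abs_of_pos ht, abs_two] at this
      nlinarith [hv.1]
    rw [h1, norm_div, Complex.norm_I, div_one, Complex.norm_real, Real.norm_eq_abs, abs_div,
      abs_neg, abs_pow, abs_mul, abs_of_pos hv0, Real.rpow_neg hv0.le]
    norm_cast
    rw [div_le_iff₀ (by have := abs_pos.mpr (Complex.ofReal_ne_zero.mp (by exact_mod_cast hne hv));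
                        positivity)]
    have h3 := pow_le_pow_left₀ (by positivity) (hlow hv) 2
    calc |2 * l * v - t| ≤ 13 / 6 * |l| * v := h2
      _ ≤ (v ^ 3)⁻¹ * (v ^ 2 * (5 / 6 * |l| * v) ^ 2) := by
        have : (v ^ 3)⁻¹ * (v ^ 2 * (5 / 6 * |l| * v) ^ 2) = 25 / 36 * |l| * |l| * v := by
          field_simp; norm_num
        rw [this]
        gcongr
        nlinarith
      _ ≤ _ := by
        rw [mul_pow v]
        gcongr
  have hPc : ContinuousOn P (Set.Icc a b) := fun v hv => (hPd hv).continuousAt.continuousWithinAt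
  have hGc : ContinuousOn G (Set.Icc a b) := fun v hv => (hGd hv).continuousAt.continuousWithinAt
  have hPc' : ContinuousOn (fun v : ℝ => P v * (Complex.I * (l * v - t) / v)) (Set.Icc a b) :=
    hPc.mul (ContinuousOn.div (by fun_prop) (by fun_prop) fun v hv => hne0 hv)
  have hGc' : ContinuousOn G' (Set.Icc a b) := by
    refine ContinuousOn.div (by fun_prop) (by fun_prop) fun v hv => ?_
    exact mul_ne_zero Complex.I_ne_zero (pow_ne_zero 2 (mul_ne_zero (hne0 hv) (hne hv)))
  have hparts := integral_mul_deriv_eq_deriv_mul (a := a) (b := b) (fun v hv => hGd (hu ▸ hv))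
    (fun v hv => hPd (hu ▸ hv)) (hu ▸ hGc').intervalIntegrable (hu ▸ hPc').intervalIntegrable
  have hcongr : ∫ v in a..b, Complex.exp (l * v * Complex.I) * (v : ℂ) ^ (-(t * Complex.I) - 2) =
      ∫ v in a..b, G v * (P v * (Complex.I * (l * v - t) / v)) := by
    refine integral_congr fun v hv => ?_
    have h3 := hne0 (hu ▸ hv)
    have h4 := hne (hu ▸ hv)
    simp only [hG, hP]
    rw [Complex.cpow_sub _ _ h3, show (2 : ℂ) = ((2 : ℕ) : ℂ) by norm_num, Complex.cpow_natCast]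
    field_simp
  have hint : ‖∫ v in a..b, G' v * P v‖ ≤ 1 / 2 * (1 / a ^ 2) := by
    have h0 : (0 : ℝ) ∉ Set.uIcc a b := by
      rw [hu]; exact fun h => absurd h.1 (not_le.mpr ha)
    have h1 : ‖∫ v in a..b, G' v * P v‖ ≤ ∫ v in a..b, v ^ (-3 : ℝ) := by
      refine norm_integral_le_of_norm_le hab ?_ (intervalIntegrable_rpow (Or.inr h0))
      refine Filter.Eventually.of_forall fun v hv => ?_
      have hv' := Set.Ioc_subset_Icc_self hv
      rw [norm_mul, hPn hv', mul_one]
      exact hG'n hv'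
    refine h1.trans ?_
    rw [integral_rpow (Or.inr ⟨by norm_num, h0⟩)]
    have hb : 0 < b := ha.trans_le hab
    have h2 : (0 : ℝ) ≤ (b ^ 2)⁻¹ := by positivity
    norm_num
    linarith
  rw [hcongr, hparts]
  have hA := Set.left_mem_Icc.mpr hab
  have hB := Set.right_mem_Icc.mpr hab
  calc ‖G b * P b - G a * P a - ∫ v in a..b, G' v * P v‖
      ≤ ‖G b * P b‖ + ‖G a * P a‖ + ‖∫ v in a..b, G' v * P v‖ :=
        (norm_sub_le _ _).trans (add_le_add_left (norm_sub_le _ _) _)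
    _ ≤ 1 / 5 * (1 / a ^ 2) + 1 / 5 * (1 / a ^ 2) + 1 / 2 * (1 / a ^ 2) := by
        rw [norm_mul (G b), norm_mul (G a), hPn hA, hPn hB, mul_one, mul_one]
        exact add_le_add (add_le_add (hGn hB) (hGn hA)) hint
    _ ≤ 1 / a ^ 2 := by
        have : 0 ≤ 1 / a ^ 2 := by positivity
        linarith

/-! ### Fourier series of the primitive of the sawtooth -/

/-- The antiderivative `B₂(v - ⌊v⌋) / 2` of the sawtooth function. -/
noncomputable def sawtoothPrimitive (v : ℝ) : ℝ := (sawtooth v ^ 2 - 1 / 12) / 2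

theorem abs_sawtoothPrimitive_le {v : ℝ} (hv : 0 ≤ v) : |sawtoothPrimitive v| ≤ 1 / 12 := by
  have h1 : sawtooth v ^ 2 ≤ (1 / 2) ^ 2 := sq_le_sq' (abs_le.mp (abs_sawtooth_le hv)).1
    (abs_le.mp (abs_sawtooth_le hv)).2
  have h2 := sq_nonneg (sawtooth v)
  rw [sawtoothPrimitive, abs_le]
  constructor <;> linarith

theorem hasSum_cos_sawtoothPrimitive {v : ℝ} (hv : 0 ≤ v) :
    HasSum (fun n : ℕ => 1 / (n : ℝ) ^ 2 / (2 * Real.pi ^ 2) * Real.cos (2 * Real.pi * n * v))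
      (sawtoothPrimitive v) := by
  have hmem : v - ⌊v⌋₊ ∈ Set.Icc (0 : ℝ) 1 :=
    ⟨sub_nonneg.mpr (Nat.floor_le hv), by linarith [Nat.lt_floor_add_one v]⟩
  have h := (hasSum_one_div_nat_pow_mul_cos one_ne_zero hmem).div_const (2 * Real.pi ^ 2)
  convert! h using 1
  · ext n
    rw [show 2 * Real.pi * n * (v - ⌊v⌋₊) = 2 * Real.pi * n * v - ((n * ⌊v⌋₊ : ℕ) : ℝ) *
      (2 * Real.pi) by push_cast; ring, Real.cos_sub_nat_mul_two_pi]
    ring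
  · have hB : (Polynomial.map (algebraMap ℚ ℝ) (Polynomial.bernoulli (2 * 1))).eval (v - ⌊v⌋₊) =
        (v - ⌊v⌋₊) ^ 2 - (v - ⌊v⌋₊) + 1 / 6 := by
      simp [Polynomial.bernoulli_def, Finset.sum_range_succ, bernoulli_two, bernoulli_one]
      ring
    rw [hB, sawtoothPrimitive, sawtooth]
    have := Real.pi_ne_zero
    norm_num
    field_simp
    ring

theorem hasSum_one_div_sq_div_two_pi_sq :
    HasSum (fun n : ℕ => 1 / (n : ℝ) ^ 2 / (2 * Real.pi ^ 2)) (1 / 12) := by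
  convert! hasSum_zeta_two.div_const (2 * Real.pi ^ 2) using 1
  have := Real.pi_ne_zero
  field_simp
  norm_num

/-- The uniformly convergent Fourier series gives continuity across the integers with no case
distinction. -/
theorem continuousOn_sawtoothPrimitive : ContinuousOn sawtoothPrimitive (Set.Ici 0) := by
  have h : Continuous fun v : ℝ =>
      ∑' n : ℕ, 1 / (n : ℝ) ^ 2 / (2 * Real.pi ^ 2) * Real.cos (2 * Real.pi * n * v) := by
    refine continuous_tsum (fun n => by fun_prop) hasSum_one_div_sq_div_two_pi_sq.summable ?_
    intro n v
    rw [norm_mul, Real.norm_of_nonneg (by positivity)]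
    exact mul_le_of_le_one_right (by positivity) (Real.abs_cos_le_one _)
  exact h.continuousOn.congr fun v hv => (hasSum_cos_sawtoothPrimitive hv).tsum_eq.symm

/-- The sawtooth jumps at integers, so only the right derivative is available everywhere; together
with continuity it suffices for integration by parts. -/
theorem hasDerivWithinAt_sawtoothPrimitive {v : ℝ} (hv : 0 ≤ v) :
    HasDerivWithinAt sawtoothPrimitive (sawtooth v) (Set.Ioi v) v := by
  have h1 : HasDerivAt (fun w : ℝ => ((w - ⌊v⌋₊ - 1 / 2) ^ 2 - 1 / 12) / 2) (sawtooth v) v := by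
    convert! ((((((hasDerivAt_id v).sub_const (⌊v⌋₊ : ℝ)).sub_const (1 / 2)).pow 2).sub_const
      (1 / 12)).div_const 2) using 1
    simp [sawtooth]
  refine h1.hasDerivWithinAt.congr_of_eventuallyEq ?_ rfl
  have h2 : Set.Ioo v (⌊v⌋₊ + 1) ∈ nhdsWithin v (Set.Ioi v) :=
    Ioo_mem_nhdsGT (Nat.lt_floor_add_one v)
  filter_upwards [h2] with w hw
  have : ⌊w⌋₊ = ⌊v⌋₊ :=
    Nat.floor_eq_on_Ico _ _ ⟨(Nat.floor_le hv).trans hw.1.le, hw.2⟩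
  rw [sawtoothPrimitive, sawtooth, this]

open MeasureTheory intervalIntegral in
theorem norm_integral_cos_mul_cpow_le {l t a b : ℝ} (hl : 6 ≤ |l|) (ht : 0 < t) (hta : t ≤ a)
    (hab : a ≤ b) :
    ‖∫ v in a..b, (Real.cos (l * v) : ℂ) * (v : ℂ) ^ (-(t * Complex.I) - 2)‖ ≤ 1 / a ^ 2 := by
  have ha : 0 < a := ht.trans_le hta
  have hu : Set.uIcc a b = Set.Icc a b := Set.uIcc_of_le hab
  have hc : ContinuousOn (fun v : ℝ => (v : ℂ) ^ (-(t * Complex.I) - 2)) (Set.uIcc a b) :=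
    fun v hv => (Complex.continuousAt_ofReal_cpow_const v _
      (Or.inr (ha.trans_le (hu ▸ hv).1).ne')).continuousWithinAt
  have hi (m : ℝ) : IntervalIntegrable (fun v : ℝ => Complex.exp (m * v * Complex.I) *
      (v : ℂ) ^ (-(t * Complex.I) - 2)) volume a b :=
    (ContinuousOn.mul (by fun_prop) hc).intervalIntegrable
  have h1 : ∫ v in a..b, (Real.cos (l * v) : ℂ) * (v : ℂ) ^ (-(t * Complex.I) - 2) =
      ((∫ v in a..b, Complex.exp (l * v * Complex.I) * (v : ℂ) ^ (-(t * Complex.I) - 2)) +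
       ∫ v in a..b, Complex.exp ((-l : ℝ) * v * Complex.I) * (v : ℂ) ^ (-(t * Complex.I) - 2))
        / 2 := by
    rw [← integral_add (hi l) (hi (-l)), ← intervalIntegral.integral_div]
    refine integral_congr fun v _ => ?_
    simp only [Complex.ofReal_cos, Complex.cos]
    push_cast
    ring_nf
  have h2 := norm_integral_cexp_mul_cpow_le hl ht hta hab
  have h3 := norm_integral_cexp_mul_cpow_le (l := -l) (by rwa [abs_neg]) ht hta hab
  rw [h1, norm_div, Complex.norm_two]
  linarith [norm_add_le
    (∫ v in a..b, Complex.exp (l * v * Complex.I) * (v : ℂ) ^ (-(t * Complex.I) - 2))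
    (∫ v in a..b, Complex.exp ((-l : ℝ) * v * Complex.I) * (v : ℂ) ^ (-(t * Complex.I) - 2))]

-- Integrate the cosine series term by term: each frequency 2πn with n ≥ 1 exceeds 6 and contributes
-- at most its coefficient over a², and the coefficients sum to 1/12.
open MeasureTheory in
theorem norm_integral_sawtoothPrimitive_mul_cpow_le {t a b : ℝ} (ht : 0 < t) (hta : t ≤ a)
    (hab : a ≤ b) :
    ‖∫ v in a..b, (sawtoothPrimitive v : ℂ) * (v : ℂ) ^ (-(t * Complex.I) - 2)‖
      ≤ 1 / (12 * a ^ 2) := by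
  have ha : 0 < a := ht.trans_le hta
  have hu : Set.uIcc a b = Set.Icc a b := Set.uIcc_of_le hab
  have hc : ContinuousOn (fun v : ℝ => (v : ℂ) ^ (-(t * Complex.I) - 2)) (Set.uIcc a b) :=
    fun v hv => (Complex.continuousAt_ofReal_cpow_const v _
      (Or.inr (ha.trans_le (hu ▸ hv).1).ne')).continuousWithinAt
  set A : ℕ → ℝ := fun n => 1 / (n : ℝ) ^ 2 / (2 * Real.pi ^ 2) with hA
  have hA0 (n : ℕ) : 0 ≤ A n := by positivity
  have hsum : HasSum A (1 / 12) := hasSum_one_div_sq_div_two_pi_sq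
  have hS := intervalIntegral.hasSum_integral_of_dominated_convergence (μ := volume) (a := a)
    (b := b)
    (F := fun n v => ((A n * Real.cos (2 * Real.pi * n * v) : ℝ) : ℂ) *
      (v : ℂ) ^ (-(t * Complex.I) - 2))
    (f := fun v => (sawtoothPrimitive v : ℂ) * (v : ℂ) ^ (-(t * Complex.I) - 2))
    (fun n v => A n * ‖(v : ℂ) ^ (-(t * Complex.I) - 2)‖) ?_ ?_ ?_ ?_ ?_
  · refine (hS.norm_le_of_bounded (hsum.mul_right (1 / a ^ 2)) fun n => ?_).trans (le_of_eq ?_)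
    · have : ∫ v in a..b, ((A n * Real.cos (2 * Real.pi * n * v) : ℝ) : ℂ) *
          (v : ℂ) ^ (-(t * Complex.I) - 2) = (A n : ℂ) * ∫ v in a..b,
          (Real.cos (2 * Real.pi * n * v) : ℂ) * (v : ℂ) ^ (-(t * Complex.I) - 2) := by
        rw [← intervalIntegral.integral_const_mul]
        refine intervalIntegral.integral_congr fun v _ => ?_
        push_cast
        ring
      rw [this, norm_mul, Complex.norm_real, Real.norm_of_nonneg (hA0 n)]
      -- The term n = 0 vanishes because 1/0² = 0 by convention.
      rcases Nat.eq_zero_or_pos n with rfl | hn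
      · simp [hA]
      · refine mul_le_mul_of_nonneg_left ?_ (hA0 n)
        refine norm_integral_cos_mul_cpow_le ?_ ht hta hab
        rw [abs_of_nonneg (by positivity)]
        have h1 : (1 : ℝ) ≤ n := by exact_mod_cast hn
        nlinarith [Real.pi_gt_three]
    · field_simp
  · intro n
    refine ContinuousOn.aestronglyMeasurable ?_ measurableSet_uIoc
    exact (ContinuousOn.mul (by fun_prop) hc).mono Set.uIoc_subset_uIcc
  · refine fun n => Filter.Eventually.of_forall fun v _ => ?_
    rw [norm_mul, Complex.norm_real, norm_mul, Real.norm_of_nonneg (hA0 n)]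
    gcongr
    exact mul_le_of_le_one_right (hA0 n) (Real.abs_cos_le_one _)
  · exact Filter.Eventually.of_forall fun v _ => (hsum.mul_right _).summable
  · simp_rw [tsum_mul_right]
    exact (continuousOn_const.mul hc.norm).intervalIntegrable
  · refine Filter.Eventually.of_forall fun v hv => ?_
    have hv0 : 0 ≤ v := ha.le.trans (hu ▸ Set.uIoc_subset_uIcc hv).1
    exact (Complex.hasSum_ofReal.mpr (hasSum_cos_sawtoothPrimitive hv0)).mul_right _

/-! ### Sum against integral for the exponent it -/

theorem norm_ofReal_cpow_neg_mul_I {v : ℝ} (hv : 0 < v) (t : ℝ) :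
    ‖(v : ℂ) ^ (-(t * Complex.I))‖ = 1 := by
  rw [Complex.norm_cpow_eq_rpow_re_of_pos hv]
  simp

theorem norm_ofReal_cpow_neg_mul_I_sub_one {v : ℝ} (hv : 0 < v) (t : ℝ) :
    ‖(v : ℂ) ^ (-(t * Complex.I) - 1)‖ = 1 / v := by
  rw [Complex.norm_cpow_eq_rpow_re_of_pos hv]
  simp [Real.rpow_neg_one]

open MeasureTheory intervalIntegral in
theorem norm_integral_sawtooth_mul_cpow_le {t a b : ℝ} (ha : 1 ≤ a) (ht : 0 < t) (hta : t ≤ a)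
    (hab : a ≤ b) :
    t * ‖∫ v in a..b, (sawtooth v : ℂ) * (v : ℂ) ^ (-(t * Complex.I) - 1)‖ ≤ 1 / 3 := by
  have ha0 : 0 < a := ht.trans_le hta
  have hb0 : 0 < b := ha0.trans_le hab
  have hu : Set.uIcc a b = Set.Icc a b := Set.uIcc_of_le hab
  have hc (w : ℂ) : ContinuousOn (fun v : ℝ => (v : ℂ) ^ w) (Set.Icc a b) :=
    fun v hv => (Complex.continuousAt_ofReal_cpow_const v _
      (Or.inr (ha0.trans_le hv.1).ne')).continuousWithinAt
  have hne : -(t * Complex.I) - 1 ≠ 0 := fun h => by simpa using congrArg Complex.re h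
  have hcB : ContinuousOn (fun v => (sawtoothPrimitive v : ℂ)) (Set.Icc a b) :=
    Complex.continuous_ofReal.comp_continuousOn
      (continuousOn_sawtoothPrimitive.mono fun v hv => ha0.le.trans hv.1)
  have hpos {v : ℝ} (hv : v ∈ Set.Ioo (min a b) (max a b)) : 0 < v := by
    rw [min_eq_left hab] at hv; exact ha0.trans hv.1
  have hparts := integral_mul_deriv_eq_deriv_mul_of_hasDeriv_right (a := a) (b := b)
    (u := fun v : ℝ => (v : ℂ) ^ (-(t * Complex.I) - 1))
    (u' := fun v : ℝ => (-(t * Complex.I) - 1) * (v : ℂ) ^ (-(t * Complex.I) - 1 - 1))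
    (v := fun v => (sawtoothPrimitive v : ℂ)) (v' := fun v => (sawtooth v : ℂ))
    (hu ▸ hc _) (hu ▸ hcB)
    (fun v hv => (hasDerivAt_ofReal_cpow_const (hpos hv).ne' hne).hasDerivWithinAt)
    (fun v hv => (hasDerivWithinAt_sawtoothPrimitive (hpos hv).le).ofReal_comp)
    (hu ▸ continuousOn_const.mul (hc _) : ContinuousOn _ (Set.uIcc a b)).intervalIntegrable
    (by simpa using intervalIntegrable_sawtooth_mul ha0.le hab continuousOn_const (f := fun _ => 1))
  have h1 : ∫ v in a..b, (sawtooth v : ℂ) * (v : ℂ) ^ (-(t * Complex.I) - 1) =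
      (b : ℂ) ^ (-(t * Complex.I) - 1) * sawtoothPrimitive b
        - (a : ℂ) ^ (-(t * Complex.I) - 1) * sawtoothPrimitive a
        - (-(t * Complex.I) - 1) *
          ∫ v in a..b, (sawtoothPrimitive v : ℂ) * (v : ℂ) ^ (-(t * Complex.I) - 2) := by
    rw [← intervalIntegral.integral_const_mul]
    refine Eq.trans (integral_congr fun v _ => mul_comm _ _) (hparts.trans ?_)
    congr 1
    refine integral_congr fun v _ => ?_
    rw [show -(t * Complex.I) - 1 - 1 = -(t * Complex.I) - 2 by ring]
    ring
  have h2 {v : ℝ} (hv : a ≤ v) :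
      ‖(v : ℂ) ^ (-(t * Complex.I) - 1) * sawtoothPrimitive v‖ ≤ 1 / a * (1 / 12) := by
    have hv0 := ha0.trans_le hv
    rw [norm_mul, norm_ofReal_cpow_neg_mul_I_sub_one hv0, Complex.norm_real]
    gcongr
    exact abs_sawtoothPrimitive_le hv0.le
  have h3 : ‖-(t * Complex.I) - 1‖ ≤ t + 1 := by
    refine (norm_sub_le _ _).trans (le_of_eq ?_)
    simp [abs_of_pos ht]
  have h4 := norm_integral_sawtoothPrimitive_mul_cpow_le ht hta hab
  have h5 : ‖∫ v in a..b, (sawtooth v : ℂ) * (v : ℂ) ^ (-(t * Complex.I) - 1)‖ ≤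
      1 / a * (1 / 12) + 1 / a * (1 / 12) + (t + 1) * (1 / (12 * a ^ 2)) := by
    rw [h1]
    refine (norm_sub_le _ _).trans (add_le_add ((norm_sub_le _ _).trans
      (add_le_add (h2 hab) (h2 le_rfl))) ?_)
    rw [norm_mul]
    gcongr
  -- Here t ≤ a and 1 ≤ a, so t + 1 ≤ 2a.
  calc _ ≤ a * (1 / a * (1 / 12) + 1 / a * (1 / 12) + (a + a) * (1 / (12 * a ^ 2))) := by
        gcongr
        refine h5.trans ?_
        gcongr
    _ = 1 / 3 := by field_simp; norm_num

-- Removes a ≥ 1: the part of the range below 1 has length at most 1 and integrand at most 1/(2a),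
-- which costs another 1/2 since t ≤ a.
open MeasureTheory intervalIntegral in
theorem mul_norm_integral_sawtooth_mul_cpow_le {t a b : ℝ} (ht : 0 < t) (hta : t ≤ a)
    (hab : a ≤ b) :
    t * ‖∫ v in a..b, (sawtooth v : ℂ) * (v : ℂ) ^ (-(t * Complex.I) - 1)‖ ≤ 5 / 6 := by
  have ha : 0 < a := ht.trans_le hta
  have hsmall {c : ℝ} (hac : a ≤ c) (hc : c ≤ 1) :
      t * ‖∫ v in a..c, (sawtooth v : ℂ) * (v : ℂ) ^ (-(t * Complex.I) - 1)‖ ≤ 1 / 2 := by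
    have h1 : ‖∫ v in a..c, (sawtooth v : ℂ) * (v : ℂ) ^ (-(t * Complex.I) - 1)‖ ≤
        1 / 2 * (1 / a) * |c - a| := by
      refine norm_integral_le_of_norm_le_const fun v hv => ?_
      rw [Set.uIoc_of_le hac] at hv
      have hv0 : 0 < v := ha.trans hv.1
      rw [norm_mul, norm_ofReal_cpow_neg_mul_I_sub_one hv0, Complex.norm_real]
      gcongr
      · exact abs_sawtooth_le hv0.le
      · exact hv.1.le
    rw [abs_of_nonneg (sub_nonneg.mpr hac)] at h1
    calc _ ≤ a * (1 / 2 * (1 / a) * (c - a)) := by gcongr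
      _ = 1 / 2 * (c - a) := by field_simp
      _ ≤ 1 / 2 := by linarith
  rcases le_total 1 a with h1a | ha1
  · linarith [norm_integral_sawtooth_mul_cpow_le h1a ht hta hab]
  rcases le_total b 1 with hb1 | h1b
  · linarith [hsmall hab hb1]
  have hi {c d : ℝ} (hc : 0 < c) (hcd : c ≤ d) : IntervalIntegrable
      (fun v => (sawtooth v : ℂ) * (v : ℂ) ^ (-(t * Complex.I) - 1)) volume c d :=
    intervalIntegrable_sawtooth_mul hc.le hcd fun v hv =>
      (Complex.continuousAt_ofReal_cpow_const v _
        (Or.inr (hc.trans_le hv.1).ne')).continuousWithinAt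
  rw [← integral_add_adjacent_intervals (hi ha ha1) (hi one_pos h1b)]
  have h1 := hsmall ha1 le_rfl
  have h2 := norm_integral_sawtooth_mul_cpow_le le_rfl ht (hta.trans ha1) h1b
  have h3 := norm_add_le (∫ v in a..1, (sawtooth v : ℂ) * (v : ℂ) ^ (-(t * Complex.I) - 1))
    (∫ v in (1 : ℝ)..b, (sawtooth v : ℂ) * (v : ℂ) ^ (-(t * Complex.I) - 1))
  nlinarith [mul_le_mul_of_nonneg_left h3 ht.le]

open MeasureTheory intervalIntegral in
theorem sum_cpow_eq_integral_add {s : ℂ} (hs : s ≠ 0) {a b : ℝ} (ha : 0 < a) (hab : a ≤ b) :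
    ∑ k ∈ Finset.Ioc ⌊a⌋₊ ⌊b⌋₊, (k : ℂ) ^ (-s) = (∫ v in a..b, (v : ℂ) ^ (-s))
      - sawtooth b * (b : ℂ) ^ (-s) + sawtooth a * (a : ℂ) ^ (-s)
      - s * ∫ v in a..b, (sawtooth v : ℂ) * (v : ℂ) ^ (-s - 1) := by
  have h := sum_Ioc_floor_eq_integral_add (f := fun v : ℝ => (v : ℂ) ^ (-s))
    (f' := fun v : ℝ => -s * (v : ℂ) ^ (-s - 1)) ha.le hab
    (fun v hv => hasDerivAt_ofReal_cpow_const (ha.trans_le hv.1).ne' (neg_ne_zero.mpr hs))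
    (continuousOn_const.mul fun v hv => (Complex.continuousAt_ofReal_cpow_const v _
        (Or.inr (ha.trans_le hv.1).ne')).continuousWithinAt)
  simp only [Complex.ofReal_natCast] at h
  rw [h, sub_eq_add_neg _ (s * _), ← neg_mul, ← intervalIntegral.integral_const_mul]
  congr 1
  exact integral_congr fun v _ => by ring

open MeasureTheory in
theorem norm_sum_cpow_neg_mul_I_sub_integral_le {t a b : ℝ} (ht : 0 < t) (hta : t ≤ a)
    (hab : a ≤ b) :
    ‖∑ k ∈ Finset.Ioc ⌊a⌋₊ ⌊b⌋₊, (k : ℂ) ^ (-(t * Complex.I))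
      - ∫ v in a..b, (v : ℂ) ^ (-(t * Complex.I))‖ ≤ 11 / 6 := by
  have ha : 0 < a := ht.trans_le hta
  have hbd {v : ℝ} (hv : 0 < v) : ‖sawtooth v * (v : ℂ) ^ (-(t * Complex.I))‖ ≤ 1 / 2 := by
    rw [norm_mul, norm_ofReal_cpow_neg_mul_I hv, mul_one, Complex.norm_real]
    exact abs_sawtooth_le hv.le
  have h1 := hbd ha
  have h2 := hbd (ha.trans_le hab)
  have h3 : ‖t * Complex.I * ∫ v in a..b, (sawtooth v : ℂ) * (v : ℂ) ^ (-(t * Complex.I) - 1)‖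
      ≤ 5 / 6 := by
    rw [norm_mul, norm_mul, Complex.norm_I, mul_one, Complex.norm_real, Real.norm_of_nonneg ht.le]
    exact mul_norm_integral_sawtooth_mul_cpow_le ht hta hab
  rw [sum_cpow_eq_integral_add (by simp [ht.ne']) ha hab]
  generalize sawtooth b * (b : ℂ) ^ (-(t * Complex.I)) = B at *
  generalize sawtooth a * (a : ℂ) ^ (-(t * Complex.I)) = A at *
  generalize t * Complex.I * (∫ v in a..b, (sawtooth v : ℂ) * (v : ℂ) ^ (-(t * Complex.I) - 1)) = D
    at *
  generalize (∫ v in a..b, (v : ℂ) ^ (-(t * Complex.I))) = J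
  rw [show J - B + A - D - J = A - B - D by ring]
  linarith [norm_sub_le (A - B) D, norm_sub_le A B]

/-! ### Partial summation and the passage to σ > 0 -/

open MeasureTheory intervalIntegral in
/-- Partial summation: weighting a bounded difference between a sum and an integral by a
nonnegative decreasing function multiplies the bound by the initial weight. -/
theorem norm_sum_mul_sub_integral_mul_le {c : ℕ → ℂ} {j J : ℝ → ℂ} {f f' : ℝ → ℝ} {a b M : ℝ}
    (ha : 0 ≤ a) (hab : a ≤ b) (hf : ∀ v ∈ Set.Icc a b, HasDerivAt f (f' v) v)
    (hf' : ContinuousOn f' (Set.Icc a b)) (hf'0 : ∀ v ∈ Set.Icc a b, f' v ≤ 0) (hfb : 0 ≤ f b)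
    (hJ : ∀ v ∈ Set.Icc a b, HasDerivAt J (j v) v) (hj : ContinuousOn j (Set.Icc a b))
    (hM : ∀ u ∈ Set.Icc a b, ‖∑ k ∈ Finset.Ioc ⌊a⌋₊ ⌊u⌋₊, c k - (J u - J a)‖ ≤ M) :
    ‖∑ k ∈ Finset.Ioc ⌊a⌋₊ ⌊b⌋₊, (f k : ℂ) * c k - ∫ v in a..b, (f v : ℂ) * j v‖ ≤ M * f a := by
  have hu : Set.uIcc a b = Set.Icc a b := Set.uIcc_of_le hab
  have hfC : ∀ v ∈ Set.Icc a b, HasDerivAt (fun v => (f v : ℂ)) (f' v : ℂ) v :=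
    fun v hv => (hf v hv).ofReal_comp
  have hfC' : ContinuousOn (fun v => (f' v : ℂ)) (Set.Icc a b) :=
    Complex.continuous_ofReal.comp_continuousOn hf'
  have hderiv : Set.EqOn (deriv fun v => (f v : ℂ)) (fun v => (f' v : ℂ)) (Set.Icc a b) :=
    fun v hv => (hfC v hv).deriv
  have hint : IntegrableOn (deriv fun v => (f v : ℂ)) (Set.Icc a b) :=
    (hfC'.integrableOn_Icc).congr_fun hderiv.symm measurableSet_Icc
  -- Cutting the coefficients at ⌊a⌋ removes the boundary term at a from Abel summation.
  set c' : ℕ → ℂ := fun k => if ⌊a⌋₊ < k then c k else 0 with hc'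
  have hsum (n : ℕ) : ∑ k ∈ Finset.Icc 0 n, c' k = ∑ k ∈ Finset.Ioc ⌊a⌋₊ n, c k := by
    rw [hc', ← Finset.sum_filter]
    refine Finset.sum_congr ?_ fun _ _ => rfl
    ext k
    simp [and_comm]
  have key := sum_mul_eq_sub_sub_integral_mul c' ha hab
    (fun v hv => (hfC v hv).differentiableAt) hint
  have hi' := integrableOn_mul_sum_Icc (m := 0) c' ha hint
  simp only [hsum] at key hi'
  rw [Finset.Ioc_self, Finset.sum_empty, mul_zero, sub_zero, ← integral_of_le hab] at key
  have hlhs : ∑ k ∈ Finset.Ioc ⌊a⌋₊ ⌊b⌋₊, (f k : ℂ) * c' k =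
      ∑ k ∈ Finset.Ioc ⌊a⌋₊ ⌊b⌋₊, (f k : ℂ) * c k :=
    Finset.sum_congr rfl fun k hk => by rw [hc']; simp only [(Finset.mem_Ioc.mp hk).1, if_true]
  have hcongr : ∫ v in a..b, deriv (fun v => (f v : ℂ)) v * ∑ k ∈ Finset.Ioc ⌊a⌋₊ ⌊v⌋₊, c k =
      ∫ v in a..b, (f' v : ℂ) * ∑ k ∈ Finset.Ioc ⌊a⌋₊ ⌊v⌋₊, c k :=
    integral_congr fun v hv => by simp only [hderiv (hu ▸ hv)]
  have hi1 : IntervalIntegrable (fun v => (f' v : ℂ) * ∑ k ∈ Finset.Ioc ⌊a⌋₊ ⌊v⌋₊, c k)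
      volume a b := by
    rw [intervalIntegrable_iff_integrableOn_Icc_of_le hab]
    exact hi'.congr_fun (fun v hv => by simp only [hderiv hv]) measurableSet_Icc
  have hi2 : IntervalIntegrable (fun v => (f' v : ℂ) * (J v - J a)) volume a b := by
    refine ContinuousOn.intervalIntegrable (hu ▸ hfC'.mul (ContinuousOn.sub ?_ continuousOn_const))
    exact fun v hv => (hJ v hv).continuousAt.continuousWithinAt
  have hparts := integral_mul_deriv_eq_deriv_mul (a := a) (b := b) (v := fun v => J v - J a)
    (fun v hv => hfC v (hu ▸ hv)) (fun v hv => (hJ v (hu ▸ hv)).sub_const _)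
    (hu ▸ hfC' : ContinuousOn _ (Set.uIcc a b)).intervalIntegrable
    (hu ▸ hj : ContinuousOn _ (Set.uIcc a b)).intervalIntegrable
  -- With D the unweighted difference, the error is f(b)D(b) - ∫ f'D; as f' ≤ 0 it is at most M(f(b)
  -- + f(a) - f(b)).
  have hE : ∑ k ∈ Finset.Ioc ⌊a⌋₊ ⌊b⌋₊, (f k : ℂ) * c k - ∫ v in a..b, (f v : ℂ) * j v =
      f b * (∑ k ∈ Finset.Ioc ⌊a⌋₊ ⌊b⌋₊, c k - (J b - J a)) -
        ∫ v in a..b, (f' v : ℂ) * (∑ k ∈ Finset.Ioc ⌊a⌋₊ ⌊v⌋₊, c k - (J v - J a)) := by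
    simp only [mul_sub _ (Finset.sum _ _) _]
    rw [integral_sub hi1 hi2, ← hlhs, key, hcongr, hparts]
    ring
  have hfi : IntervalIntegrable f' volume a b :=
    (hu ▸ hf' : ContinuousOn _ (Set.uIcc a b)).intervalIntegrable
  have hftc : ∫ v in a..b, f' v = f b - f a :=
    integral_eq_sub_of_hasDerivAt (fun v hv => hf v (hu ▸ hv)) hfi
  have hI : ‖∫ v in a..b, (f' v : ℂ) * (∑ k ∈ Finset.Ioc ⌊a⌋₊ ⌊v⌋₊, c k - (J v - J a))‖ ≤
      ∫ v in a..b, -M * f' v := by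
    refine norm_integral_le_of_norm_le hab (Filter.Eventually.of_forall fun v hv => ?_)
      (hfi.const_mul _)
    have hv' := Set.Ioc_subset_Icc_self hv
    rw [norm_mul, Complex.norm_real, Real.norm_of_nonpos (hf'0 v hv')]
    linarith [mul_le_mul_of_nonneg_left (hM v hv') (neg_nonneg.mpr (hf'0 v hv'))]
  rw [intervalIntegral.integral_const_mul, hftc] at hI
  have hB : ‖f b * (∑ k ∈ Finset.Ioc ⌊a⌋₊ ⌊b⌋₊, c k - (J b - J a))‖ ≤ f b * M := by
    rw [norm_mul, Complex.norm_real, Real.norm_of_nonneg hfb]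
    exact mul_le_mul_of_nonneg_left (hM b (Set.right_mem_Icc.mpr hab)) hfb
  rw [hE]
  linarith [norm_sub_le (f b * (∑ k ∈ Finset.Ioc ⌊a⌋₊ ⌊b⌋₊, c k - (J b - J a)))
    (∫ v in a..b, (f' v : ℂ) * (∑ k ∈ Finset.Ioc ⌊a⌋₊ ⌊v⌋₊, c k - (J v - J a)))]

open MeasureTheory intervalIntegral in
theorem norm_sum_cpow_sub_integral_le {s : ℂ} {a b : ℝ} (hs : 0 < s.re) (ht : 0 < s.im)
    (hta : s.im ≤ a) (hab : a ≤ b) :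
    ‖∑ k ∈ Finset.Ioc ⌊a⌋₊ ⌊b⌋₊, (k : ℂ) ^ (-s) - ∫ v in a..b, (v : ℂ) ^ (-s)‖
      ≤ 11 / 6 * a ^ (-s.re) := by
  have ha : 0 < a := ht.trans_le hta
  have hu : Set.uIcc a b = Set.Icc a b := Set.uIcc_of_le hab
  have hpos {v : ℝ} (hv : v ∈ Set.Icc a b) : 0 < v := ha.trans_le hv.1
  have hsplit {v : ℝ} (hv : 0 < v) :
      (v : ℂ) ^ (-s) = ((v ^ (-s.re) : ℝ) : ℂ) * (v : ℂ) ^ (-(s.im * Complex.I)) := by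
    rw [Complex.ofReal_cpow hv.le, ← Complex.cpow_add _ _ (Complex.ofReal_ne_zero.mpr hv.ne')]
    congr 1
    conv_lhs => rw [← Complex.re_add_im s]
    push_cast
    ring
  have hw : -(s.im * Complex.I) ≠ -1 := fun h => by simpa using congrArg Complex.re h
  have hcont : ContinuousOn (fun v : ℝ => (v : ℂ) ^ (-(s.im * Complex.I))) (Set.Icc a b) :=
    fun v hv => (Complex.continuousAt_ofReal_cpow_const v _
      (Or.inr (hpos hv).ne')).continuousWithinAt
  have hJ {v : ℝ} (hv : v ∈ Set.Icc a b) := hasDerivAt_ofReal_cpow_const' (hpos hv).ne' hw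
  have key := norm_sum_mul_sub_integral_mul_le (M := 11 / 6)
    (c := fun k => (k : ℂ) ^ (-(s.im * Complex.I)))
    (f := fun v => v ^ (-s.re)) (f' := fun v => -s.re * v ^ (-s.re - 1)) ha.le hab
    (fun v hv => Real.hasDerivAt_rpow_const (Or.inl (hpos hv).ne'))
    (continuousOn_const.mul fun v hv =>
      (Real.continuousAt_rpow_const v _ (Or.inl (hpos hv).ne')).continuousWithinAt)
    (fun v hv => mul_nonpos_of_nonpos_of_nonneg (by linarith) (Real.rpow_nonneg (hpos hv).le _))
    (Real.rpow_nonneg (ha.le.trans hab) _) (fun v hv => hJ hv) hcont ?_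
  · convert key using 3
    · refine Finset.sum_congr rfl fun k hk => ?_
      have hk0 : (0 : ℝ) < k := by exact_mod_cast (Nat.zero_le _).trans_lt (Finset.mem_Ioc.mp hk).1
      simpa using hsplit hk0
    · exact integral_congr fun v hv => hsplit (hpos (hu ▸ hv))
  · intro u hu'
    have hau : Set.uIcc a u = Set.Icc a u := Set.uIcc_of_le hu'.1
    have hsub : Set.Icc a u ⊆ Set.Icc a b := Set.Icc_subset_Icc_right hu'.2
    rw [← integral_eq_sub_of_hasDerivAt (fun v hv => hJ (hsub (hau ▸ hv)))
      (hau ▸ hcont.mono hsub : ContinuousOn _ (Set.uIcc a u)).intervalIntegrable]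
    exact norm_sum_cpow_neg_mul_I_sub_integral_le ht hta hu'.1

/-! ### The zeta function for σ > 0 and the limit σ → 0 -/

section

open MeasureTheory Filter Topology

/-- Mellin transform representation of `ζ(s) - 1 / (s - 1)` on the right half-plane. -/
noncomputable def zetaRegularPart (s : ℂ) : ℂ :=
  1 / 2 - s * mellin (Set.indicator (Set.Ioi 1) fun v => (sawtooth v : ℂ)) (-s)

theorem norm_indicator_sawtooth_le (v : ℝ) :
    ‖Set.indicator (Set.Ioi 1) (fun v => (sawtooth v : ℂ)) v‖ ≤ 1 / 2 := by
  by_cases hv : v ∈ Set.Ioi (1 : ℝ)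
  · rw [Set.indicator_of_mem hv, Complex.norm_real]
    exact abs_sawtooth_le (zero_le_one.trans (le_of_lt hv))
  · rw [Set.indicator_of_notMem hv, norm_zero]
    norm_num

theorem measurable_indicator_sawtooth :
    Measurable (Set.indicator (Set.Ioi 1) fun v => (sawtooth v : ℂ)) :=
  (Complex.measurable_ofReal.comp measurable_sawtooth).indicator measurableSet_Ioi

theorem differentiableAt_zetaRegularPart {s : ℂ} (hs : 0 < s.re) :
    DifferentiableAt ℂ zetaRegularPart s := by
  refine (differentiableAt_const _).sub (differentiableAt_id.mul ?_)
  have h : DifferentiableAt ℂ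
      (mellin (Set.indicator (Set.Ioi 1) fun v => (sawtooth v : ℂ))) (-s) := by
    -- Boundedness gives the exponent 0 at infinity; near 0 the function vanishes, so any b < -σ
    -- would do.
    refine mellin_differentiableAt_of_isBigO_rpow (a := 0) (b := -s.re - 1) ?_ ?_ (by simpa) ?_
      (by simp)
    · refine LocallyIntegrable.locallyIntegrableOn ?_ _
      refine (locallyIntegrable_const (1 / 2 : ℝ)).mono
        measurable_indicator_sawtooth.aestronglyMeasurable (Eventually.of_forall fun v => ?_)
      rw [Real.norm_of_nonneg (by norm_num)]
      exact norm_indicator_sawtooth_le v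
    · refine Asymptotics.IsBigO.of_bound (1 / 2) (Eventually.of_forall fun v => ?_)
      simpa using norm_indicator_sawtooth_le v
    · refine Asymptotics.IsBigO.of_bound 1 ?_
      filter_upwards [Ioo_mem_nhdsGT (zero_lt_one (α := ℝ))] with v hv
      rw [Set.indicator_of_notMem (Set.notMem_Ioi.mpr hv.2.le), norm_zero]
      positivity
  exact h.comp s differentiableAt_id.neg

theorem mellin_indicator_sawtooth_neg (s : ℂ) :
    mellin (Set.indicator (Set.Ioi 1) fun v => (sawtooth v : ℂ)) (-s) =
      ∫ v in Set.Ioi (1 : ℝ), (sawtooth v : ℂ) * (v : ℂ) ^ (-s - 1) := by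
  have h (v : ℝ) : (v : ℂ) ^ (-s - 1) • Set.indicator (Set.Ioi 1) (fun v => (sawtooth v : ℂ)) v =
      Set.indicator (Set.Ioi 1) (fun v : ℝ => (sawtooth v : ℂ) * (v : ℂ) ^ (-s - 1)) v := by
    by_cases hv : v ∈ Set.Ioi (1 : ℝ)
    · rw [Set.indicator_of_mem hv, Set.indicator_of_mem hv, smul_eq_mul, mul_comm]
    · rw [Set.indicator_of_notMem hv, Set.indicator_of_notMem hv, smul_zero]
  rw [mellin]
  simp_rw [h]
  rw [setIntegral_indicator measurableSet_Ioi,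
    Set.inter_eq_right.mpr (Set.Ioi_subset_Ioi zero_le_one)]

theorem integrableOn_sawtooth_mul_cpow {s : ℂ} (hs : 0 < s.re) :
    IntegrableOn (fun v : ℝ => (sawtooth v : ℂ) * (v : ℂ) ^ (-s - 1)) (Set.Ioi 1) := by
  refine Integrable.bdd_mul (c := 1 / 2)
    (integrableOn_Ioi_cpow_of_lt (by simp; linarith) one_pos)
    (Complex.measurable_ofReal.comp measurable_sawtooth).aestronglyMeasurable ?_
  filter_upwards [ae_restrict_mem measurableSet_Ioi] with v hv
  rw [Complex.norm_real, Real.norm_eq_abs]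
  exact abs_sawtooth_le (zero_le_one.trans (le_of_lt hv))

theorem integral_cpow_neg {s : ℂ} (hs : s ≠ 1) {a b : ℝ} (ha : 0 < a) (hab : a ≤ b) :
    ∫ v in a..b, (v : ℂ) ^ (-s) = (a : ℂ) ^ (1 - s) / (s - 1) - (b : ℂ) ^ (1 - s) / (s - 1) := by
  have hs' : s - 1 ≠ 0 := sub_ne_zero.mpr hs
  have hs'' : 1 - s ≠ 0 := sub_ne_zero.mpr hs.symm
  rw [integral_cpow (Or.inr ⟨fun h => hs (neg_injective h), ?_⟩),
    show -s + 1 = 1 - s by ring]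
  · field_simp
    ring
  · rw [Set.uIcc_of_le hab]
    exact fun h => absurd h.1 (not_le.mpr ha)

theorem tendsto_natCast_cpow_neg {s : ℂ} (hs : 0 < s.re) :
    Tendsto (fun N : ℕ => (N : ℂ) ^ (-s)) atTop (𝓝 0) := by
  rw [tendsto_zero_iff_norm_tendsto_zero]
  refine ((tendsto_rpow_neg_atTop hs).comp tendsto_natCast_atTop_atTop).congr' ?_
  filter_upwards [eventually_gt_atTop 0] with N hN
  rw [Complex.norm_natCast_cpow_of_pos hN]
  rfl

/-- Euler–Maclaurin on [1, N]: the sawtooth is -1/2 at integers, so the term n = 1 and the boundary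
at 1 leave 1 - 1/2, and the boundary at N tends to 0. -/
theorem tendsto_sum_add_cpow {s : ℂ} (hs : 0 < s.re) (hs1 : s ≠ 1) :
    Tendsto (fun N : ℕ => ∑ n ∈ Finset.Icc 1 N, (n : ℂ) ^ (-s) + (N : ℂ) ^ (1 - s) / (s - 1))
      atTop (𝓝 (1 / (s - 1) + zetaRegularPart s)) := by
  have hs0 : s ≠ 0 := fun h => by simp [h] at hs
  have h1 := intervalIntegral_tendsto_integral_Ioi 1 (integrableOn_sawtooth_mul_cpow hs)
    tendsto_natCast_atTop_atTop (l := atTop (α := ℕ))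
  have h2 := (((tendsto_natCast_cpow_neg hs).const_mul (1 / 2)).const_add
    (1 / (s - 1) + 1 / 2)).sub (h1.const_mul s)
  rw [mul_zero, add_zero, ← mellin_indicator_sawtooth_neg, add_sub_assoc] at h2
  refine h2.congr' ?_
  filter_upwards [eventually_ge_atTop 1] with N hN
  have hN' : (1 : ℝ) ≤ N := by exact_mod_cast hN
  have h3 := sum_cpow_eq_integral_add hs0 one_pos hN'
  rw [integral_cpow_neg hs1 one_pos hN', Nat.floor_one, Nat.floor_natCast] at h3
  have h4 : ∑ n ∈ Finset.Icc 1 N, (n : ℂ) ^ (-s) =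
      1 + ∑ n ∈ Finset.Ioc 1 N, (n : ℂ) ^ (-s) := by
    rw [← Finset.add_sum_Ioc_eq_sum_Icc hN, Nat.cast_one, Complex.one_cpow]
  rw [h4, h3]
  simp only [sawtooth, Nat.floor_natCast, Nat.floor_one, Complex.ofReal_one, Complex.one_cpow]
  push_cast
  ring

theorem riemannZeta_eq_add_zetaRegularPart_of_one_lt_re {s : ℂ} (hs : 1 < s.re) :
    riemannZeta s = 1 / (s - 1) + zetaRegularPart s := by
  have hs1 : s ≠ 1 := fun h => by simp [h] at hs
  have hs0 : s ≠ 0 := fun h => by norm_num [h] at hs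
  refine tendsto_nhds_unique ?_ (tendsto_sum_add_cpow (zero_lt_one.trans hs) hs1)
  have h1 := ((Complex.summable_one_div_nat_cpow.mpr hs).hasSum.tendsto_sum_nat).comp
    (tendsto_add_atTop_nat 1)
  rw [← zeta_eq_tsum_one_div_nat_cpow hs] at h1
  have h2 : Tendsto (fun N : ℕ => (N : ℂ) ^ (1 - s) / (s - 1)) atTop (𝓝 0) := by
    have := (tendsto_natCast_cpow_neg (s := s - 1) (by simpa using hs)).div_const (s - 1)
    simpa using this
  have h3 := h1.add h2
  rw [add_zero] at h3
  refine h3.congr fun N => ?_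
  congr 1
  simp only [Function.comp_apply]
  rw [Finset.range_eq_Ico, Finset.sum_eq_sum_Ico_succ_bot (Nat.succ_pos N), Nat.cast_zero,
    Complex.zero_cpow hs0, div_zero, zero_add]
  refine Finset.sum_congr rfl fun n _ => ?_
  rw [Complex.cpow_neg, one_div]

/-- Identity theorem from Re s > 1. Comparing the functions with the pole 1/(s-1) removed keeps the
domain a convex half-plane. -/
theorem riemannZeta_eq_add_zetaRegularPart {s : ℂ} (hs : 0 < s.re) (hs1 : s ≠ 1) :
    riemannZeta s = 1 / (s - 1) + zetaRegularPart s := by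
  have hopen : IsOpen {s : ℂ | 0 < s.re} := isOpen_lt continuous_const Complex.continuous_re
  have h1 : AnalyticOnNhd ℂ riemannZeta₀ {s : ℂ | 0 < s.re} :=
    differentiable_riemannZeta₀.differentiableOn.analyticOnNhd hopen
  have h2 : AnalyticOnNhd ℂ zetaRegularPart {s : ℂ | 0 < s.re} :=
    DifferentiableOn.analyticOnNhd
      (fun w hw => (differentiableAt_zetaRegularPart hw).differentiableWithinAt) hopen
  have h3 : Set.EqOn riemannZeta₀ zetaRegularPart {s : ℂ | 0 < s.re} := by
    refine h1.eqOn_of_preconnected_of_eventuallyEq h2 (convex_halfSpace_re_gt 0).isPreconnected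
      (z₀ := 2) (by simp) ?_
    have h4 : {s : ℂ | 1 < s.re} ∈ 𝓝 (2 : ℂ) :=
      (isOpen_lt continuous_const Complex.continuous_re).mem_nhds (by simp)
    filter_upwards [h4] with w hw
    have hw1 : w ≠ 1 := fun h => by simp [h] at hw
    have := riemannZeta_eq_add_zetaRegularPart_of_one_lt_re hw
    rw [riemannZeta_eq_inv_sub_add hw1, one_div] at this
    exact add_left_cancel this
  rw [riemannZeta_eq_inv_sub_add hs1, h3 hs, one_div]

theorem norm_riemannZeta_sub_le_of_re_pos {x : ℝ} {s : ℂ} (hs : 0 < s.re) (ht : 0 < s.im)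
    (htx : s.im ≤ x) :
    ‖riemannZeta s - (∑ n ∈ Finset.Icc 1 ⌊x⌋₊, (n : ℂ) ^ (-s) + (x : ℂ) ^ (1 - s) / (s - 1))‖
      ≤ 11 / 6 * x ^ (-s.re) := by
  have hx : 0 < x := ht.trans_le htx
  have hs1 : s ≠ 1 := fun h => by simp [h] at ht
  have h1 := (tendsto_sum_add_cpow hs hs1).sub_const
    (∑ n ∈ Finset.Icc 1 ⌊x⌋₊, (n : ℂ) ^ (-s) + (x : ℂ) ^ (1 - s) / (s - 1))
  rw [← riemannZeta_eq_add_zetaRegularPart hs hs1] at h1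
  refine le_of_tendsto h1.norm ?_
  filter_upwards [tendsto_natCast_atTop_atTop.eventually_ge_atTop x] with N hN
  have h2 := norm_sum_cpow_sub_integral_le hs ht htx hN
  rw [integral_cpow_neg hs1 hx hN, Nat.floor_natCast] at h2
  have h3 : ∑ n ∈ Finset.Icc 1 N, (n : ℂ) ^ (-s) = ∑ n ∈ Finset.Icc 1 ⌊x⌋₊, (n : ℂ) ^ (-s) +
      ∑ n ∈ Finset.Ioc ⌊x⌋₊ N, (n : ℂ) ^ (-s) := by
    have hN' : ⌊x⌋₊ ≤ N := Nat.floor_le_of_le hN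
    have hI (m : ℕ) : Finset.Icc 1 m = Finset.Ioc 0 m := rfl
    rw [hI, hI, Finset.sum_Ioc_consecutive _ (Nat.zero_le _) hN']
  refine le_of_eq_of_le (congrArg norm ?_) h2
  rw [h3, Complex.ofReal_natCast]
  ring

theorem norm_riemannZeta_sub_le {x : ℝ} {s : ℂ} (hs : 0 ≤ s.re) (ht : 0 < s.im)
    (htx : s.im ≤ x) :
    ‖riemannZeta s - (∑ n ∈ Finset.Icc 1 ⌊x⌋₊, (n : ℂ) ^ (-s) + (x : ℂ) ^ (1 - s) / (s - 1))‖
      ≤ 11 / 6 * x ^ (-s.re) := by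
  have hx : 0 < x := ht.trans_le htx
  have hs1 : s ≠ 1 := fun h => by simp [h] at ht
  have hx0 : (x : ℂ) ≠ 0 := Complex.ofReal_ne_zero.mpr hx.ne'
  set F : ℂ → ℂ := fun w =>
    riemannZeta w - (∑ n ∈ Finset.Icc 1 ⌊x⌋₊, (n : ℂ) ^ (-w) + (x : ℂ) ^ (1 - w) / (w - 1)) with hF
  have hFc : ContinuousAt F s := by
    refine (differentiableAt_riemannZeta hs1).continuousAt.sub (ContinuousAt.add ?_ ?_)
    · refine tendsto_finsetSum _ fun n hn => ?_
      have hn0 : (n : ℂ) ≠ 0 := Nat.cast_ne_zero.mpr (by have := (Finset.mem_Icc.mp hn).1; omega)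
      exact continuousAt_id.neg.const_cpow (Or.inl hn0)
    · exact ((continuousAt_const.sub continuousAt_id).const_cpow (Or.inl hx0)).div
        (continuousAt_id.sub continuousAt_const) (sub_ne_zero.mpr hs1)
  -- Both sides are continuous at s, so the estimate at s + e with e > 0 passes to the limit and
  -- covers σ = 0.
  have hp : Tendsto (fun e : ℝ => s + e) (𝓝[>] 0) (𝓝 s) := by
    have : Continuous fun e : ℝ => s + e := by fun_prop
    simpa using (this.tendsto 0).mono_left nhdsWithin_le_nhds
  have hr : ContinuousAt (fun w : ℂ => 11 / 6 * x ^ (-w.re)) s :=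
    continuousAt_const.mul
      ((Real.continuousAt_const_rpow hx.ne').comp Complex.continuous_re.neg.continuousAt)
  refine le_of_tendsto_of_tendsto (hFc.norm.tendsto.comp hp) (hr.tendsto.comp hp) ?_
  filter_upwards [self_mem_nhdsWithin] with e he
  have he' : (0 : ℝ) < e := he
  exact norm_riemannZeta_sub_le_of_re_pos (s := s + e) (by simp; linarith) (by simpa) (by simpa)

theorem exists_norm_le_one_riemannZeta_eq {c x : ℝ} {s : ℂ} (hc : 11 / 6 ≤ c) (hs : 0 ≤ s.re)
    (ht : 0 < s.im) (htx : s.im ≤ x) :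
    ∃ Θ : ℂ, ‖Θ‖ ≤ 1 ∧
      riemannZeta s = (∑ n ∈ Finset.Icc 1 ⌊x⌋₊, 1 / (n : ℂ) ^ s) + (x : ℂ) ^ (1 - s) / (s - 1)
        + (c : ℂ) * Θ * ((x ^ (-s.re) : ℝ) : ℂ) := by
  have hx : 0 < x := ht.trans_le htx
  have hB : 0 < c * x ^ (-s.re) := mul_pos (by linarith) (Real.rpow_pos_of_pos hx _)
  have h := (norm_riemannZeta_sub_le hs ht htx).trans
    (mul_le_mul_of_nonneg_right hc (Real.rpow_nonneg hx.le _))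
  simp only [Complex.cpow_neg, ← one_div] at h
  refine ⟨(riemannZeta s - (∑ n ∈ Finset.Icc 1 ⌊x⌋₊, 1 / (n : ℂ) ^ s +
    (x : ℂ) ^ (1 - s) / (s - 1))) / ((c * x ^ (-s.re) : ℝ) : ℂ), ?_, ?_⟩
  · rw [norm_div, Complex.norm_real, Real.norm_of_nonneg hB.le]
    exact (div_le_one hB).mpr h
  · have hne : ((c * x ^ (-s.re) : ℝ) : ℂ) ≠ 0 := Complex.ofReal_ne_zero.mpr hB.ne'
    rw [mul_right_comm, ← Complex.ofReal_mul, mul_div_cancel₀ _ hne]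
    ring

end

theorem mainTheorem1 :
    |zetaApproxConst - 2.0708| ≤ 0.00005 ∧ zetaApproxConst < 29 / 14 ∧
    ∀ (x : ℝ) (s : ℂ), 0 < x → 0 ≤ s.re → 0 < s.im → s.im ≤ x →
      (∃ Θ : ℂ, ‖Θ‖ ≤ 1 ∧
        riemannZeta s = (∑ n ∈ Finset.Icc 1 ⌊x⌋₊, 1 / (n : ℂ) ^ s)
          + (x : ℂ) ^ (1 - s) / (s - 1)
          + (29 / 14 : ℂ) * Θ * ((x ^ (-s.re) : ℝ) : ℂ)) ∧
      (∃ Θ : ℂ, ‖Θ‖ ≤ 1 ∧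
        riemannZeta s = (∑ n ∈ Finset.Icc 1 ⌊x⌋₊, 1 / (n : ℂ) ^ s)
          + (x : ℂ) ^ (1 - s) / (s - 1)
          + (zetaApproxConst : ℂ) * Θ * ((x ^ (-s.re) : ℝ) : ℂ)) := by
  refine ⟨abs_zetaApproxConst_sub_le, zetaApproxConst_lt, fun x s _ hs ht htx => ⟨?_, ?_⟩⟩
  · have h := exists_norm_le_one_riemannZeta_eq (c := 29 / 14) (by norm_num) hs ht htx
    push_cast at h ⊢
    exact h
  · refine exists_norm_le_one_riemannZeta_eq ?_ hs ht htx
    have := (abs_le.mp abs_zetaApproxConst_sub_le).1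
    norm_num at this ⊢
    linarith
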